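/- Let $m\ge 2$ and $n\ge 1$ be integers, and let $\mathcal{A}=(a_{i_1\cdots i_m})$ be a real $m$th order $n$-dimensional tensor, that is, a multi-array of real entries $a_{i_1\cdots i_m}$ with $i_1,\dots,i_m\in\{1,\dots,n\}$. For $\mathbf{x}\in\mathbb{R}^n$ let $\mathcal{A}\mathbf{x}^{m-1}\in\mathbb{R}^n$ be the vector with components $$\left(\mathcal{A}\mathbf{x}^{m-1}\right)_i=\sum_{i_2,\dots,i_m=1}^n a_{ii_2\cdots i_m}x_{i_2}\cdots x_{i_m},\qquad i=1,\dots,n.$$ The tensor $\mathcal{A}$ is called a Q-tensor if for every $\mathbf{q}\in\mathbb{R}^n$ there is an $\mathbf{x}\in\mathbb{R}^n$ with $\mathbf{x}\ge\mathbf{0}$, $\mathbf{q}+\mathcal{A}\mathbf{x}^{m-1}\ge\mathbf{0}$ and $\mathbf{x}^\top(\mathbf{q}+\mathcal{A}\mathbf{x}^{m-1})=0$ (inequalities between vectors are componentwise). Suppose that $\mathcal{A}$ is nonnegative, i.e. $a_{i_1\cdots i_m}\ge 0$ for all $i_1,\dots,i_m\in\{1,\dots,n\}$. Then $\mathcal{A}$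 is a Q-tensor if and only if $a_{ii\cdots i}>0$ for all $i\in\{1,\dots,n\}$. -/

import Mathlib

/-- A real `m`-th order `n`-dimensional tensor (hypermatrix): a multi-array of real entries
`a (i₁, …, iₘ)`, with each index in `Fin n`. The linear structure and the entrywise order are those
of functions. -/
abbrev RealTensor (m n : ℕ) : Type := (Fin m → Fin n) → ℝ

namespace RealTensor

/-- The index tuple `(i, i₂, …, iₘ)` obtained by putting `i` in front of `J = (i₂, …, iₘ)`. -/
def consIndex {m n : ℕ} (i : Fin n) (J : Fin (m - 1) → Fin n) : Fin m → Fin n :=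
  fun k => if h : k.val = 0 then i else J ⟨k.val - 1, by omega⟩

/-- The vector `A x^(m-1)`, whose `i`-th component is
`∑_{i₂, …, iₘ} a (i, i₂, …, iₘ) * x i₂ * ⋯ * x iₘ`. -/
def apply {m n : ℕ} (A : RealTensor m n) (x : Fin n → ℝ) : Fin n → ℝ :=
  fun i => ∑ J : Fin (m - 1) → Fin n, A (consIndex i J) * ∏ k, x (J k)

/-- `x` solves the tensor complementarity problem `(q, A)`:
`x ≥ 0`, `q + A x^(m-1) ≥ 0` and `xᵀ (q + A x^(m-1)) = 0`. -/
def IsTCPSolution {m n : ℕ} (q : Fin n → ℝ) (A : RealTensor m n) (x : Fin n → ℝ) : Prop :=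
  0 ≤ x ∧ 0 ≤ q + A.apply x ∧ x ⬝ᵥ (q + A.apply x) = 0

/-- `A` is a Q-tensor: the tensor complementarity problem `(q, A)` has a solution for each `q`. -/
def IsQTensor {m n : ℕ} (A : RealTensor m n) : Prop :=
  ∀ q : Fin n → ℝ, ∃ x : Fin n → ℝ, IsTCPSolution q A x

end RealTensor

/-!
For a nonnegative tensor `A`, a component of `A x^(m-1)` at `x ≥ 0` dominates its diagonal term
`a i⋯i * xᵢ^(m-1)`.

If all diagonal entries are positive, then for every `q` the component `qᵢ + (A x^(m-1))ᵢ` is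
positive on the face `xᵢ = K` of the box `[0, K]ⁿ` once `K` is large, and a complementarity problem
with this boundary behaviour is solvable by a fixed point argument
(`exists_nonlinear_complementarity_solution`). Conversely, testing the problem with `qᵢ = -1` and
`qⱼ = 1` for `j ≠ i` isolates the diagonal entry `a i⋯i` (`RealTensor.IsQTensor.diag_pos`).

The fixed point comes from Brouwer's theorem for bounded Lipschitz maps
(`LipschitzWith.exists_eq_of_bounded`), which suffices since `A x^(m-1)` is polynomial and the
projection to a box is Lipschitz. It is derived from the absence of a Lipschitz retraction
(`not_exists_lipschitz_retraction`), in the spirit of the volume argument of Milnor and Rogers. If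
`g` is Lipschitz and vanishes outside a ball, `id + t g` permutes the ball for small `t`, so the
integral over the ball of `det (1 + t Dg)` equals the volume of the ball. This integral is polynomial
in `t`, so the same holds at `t = 1`. For a retraction `id + g` the determinant at `t = 1` vanishes
almost everywhere in the ball, a contradiction.
-/

section Brouwer

open Set Metric MeasureTheory Measure
open scoped NNReal

/-! ### The Jacobian integral of a Lipschitz perturbation of the identity -/

section Jacobian

/-- Lagrange extrapolation: `t ↦ det (1 + t M)` is a polynomial of degree at most `n`, so its value at
`1` is a fixed linear combination, with weights independent of `M`, of its values at any `n + 1`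
distinct nodes. -/
theorem exists_weights_det_one_add (n : ℕ) (t : Fin (n + 1) → ℝ) (ht : Function.Injective t) :
    ∃ w : Fin (n + 1) → ℝ, ∀ M : Matrix (Fin n) (Fin n) ℝ,
      (1 + M).det = ∑ i, w i * (1 + t i • M).det := by
  refine ⟨fun i => (Lagrange.basis Finset.univ t i).eval 1, fun M => ?_⟩
  set p : Polynomial ℝ := ((Polynomial.X : Polynomial ℝ) • M.map Polynomial.C +
    (1 : Matrix (Fin n) (Fin n) ℝ).map Polynomial.C).det with hp
  have hev : ∀ s : ℝ, p.eval s = (1 + s • M).det := by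
    intro s
    rw [hp, ← Polynomial.coe_evalRingHom, RingHom.map_det]
    congr 1
    ext i j
    by_cases hij : i = j <;> simp [hij] <;> ring
  have hdeg : p.degree < (Finset.univ : Finset (Fin (n + 1))).card := by
    refine lt_of_le_of_lt Polynomial.degree_le_natDegree ?_
    have := Polynomial.natDegree_det_X_add_C_le M 1
    rw [Fintype.card_fin] at this
    simp only [Finset.card_univ, Fintype.card_fin]
    exact_mod_cast Nat.lt_succ_of_le this
  have h := congrArg (Polynomial.eval 1) (Lagrange.eq_interpolate (ht.injOn) hdeg)
  rw [hev, one_smul, Lagrange.interpolate_apply, Polynomial.eval_finsetSum] at h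
  simp only [Polynomial.eval_mul, Polynomial.eval_C, hev] at h
  rw [h]
  exact Finset.sum_congr rfl fun i _ => mul_comm _ _

variable {E : Type*} [NormedAddCommGroup E] [NormedSpace ℝ E] [FiniteDimensional ℝ E]

theorem exists_weights_continuousLinearMap_det_one_add
    (t : Fin (Module.finrank ℝ E + 1) → ℝ) (ht : Function.Injective t) :
    ∃ w : Fin (Module.finrank ℝ E + 1) → ℝ, ∀ A : E →L[ℝ] E,
      (1 + A).det = ∑ i, w i * (1 + t i • A).det := by
  obtain ⟨w, hw⟩ := exists_weights_det_one_add _ t ht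
  refine ⟨w, fun A => ?_⟩
  let b := Module.finBasis ℝ E
  have key : ∀ s : ℝ, (1 + s • A).det =
      (1 + s • LinearMap.toMatrix b b (A : E →ₗ[ℝ] E)).det := by
    intro s
    rw [ContinuousLinearMap.det, ← LinearMap.det_toMatrix b]
    congr 1
    rw [ContinuousLinearMap.toLinearMap_add, ContinuousLinearMap.toLinearMap_smul, map_add, map_smul]
    congr 1
    exact LinearMap.toMatrix_one b
  have h1 := key 1
  rw [one_smul, one_smul] at h1
  rw [h1, hw]
  simp_rw [key]

/-- A perturbation of the identity by a small Lipschitz map is a bijection of the space, by the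
contraction principle. As it fixes the complement of the ball pointwise, it permutes the ball. -/
theorem image_ball_id_add_smul {g : E → E} {K : ℝ≥0} {L t : ℝ} (hg : LipschitzWith K g)
    (hsupp : ∀ x, L ≤ ‖x‖ → g x = 0) (ht : |t| * K < 1) :
    InjOn (fun x => x + t • g x) univ ∧ (fun x => x + t • g x) '' ball 0 L = ball 0 L := by
  have hlip : LipschitzWith (‖t‖₊ * K) fun x => t • g x := (lipschitzWith_smul t).comp hg
  have hlt : ‖t‖₊ * K < 1 := by
    rw [← NNReal.coe_lt_coe]; simpa using ht
  have hinj : Function.Injective fun x => x + t • g x := by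
    intro x y hxy
    have h1 : x - y = t • g y - t • g x := by
      have : x + t • g x = y + t • g y := hxy
      rw [sub_eq_sub_iff_add_eq_add, this, add_comm]
    have h2 := hlip.dist_le_mul y x
    rw [dist_eq_norm, ← h1, dist_comm, dist_eq_norm] at h2
    by_contra hne
    have h3 : 0 < ‖x - y‖ := norm_pos_iff.2 (sub_ne_zero.2 hne)
    have h4 : ((‖t‖₊ * K : ℝ≥0) : ℝ) < 1 := by exact_mod_cast hlt
    nlinarith
  have hsurj : Function.Surjective fun x => x + t • g x := by
    intro y
    have hc : ContractingWith (‖t‖₊ * K) fun x => y - t • g x := by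
      refine ⟨hlt, ?_⟩
      simpa using (LipschitzWith.const y).sub hlip
    refine ⟨hc.fixedPoint, ?_⟩
    have h := hc.fixedPoint_isFixedPt
    have h' : y - t • g hc.fixedPoint = hc.fixedPoint := h
    show hc.fixedPoint + t • g hc.fixedPoint = y
    conv_lhs => enter [1]; rw [← h']
    exact sub_add_cancel _ _
  refine ⟨hinj.injOn, ?_⟩
  -- `x ↦ x + t g(x)` is bijective and maps the complement of the ball onto itself, hence the ball too.
  have hfix : ∀ x : E, x ∉ ball (0 : E) L → x + t • g x = x := by
    intro x hx
    rw [hsupp x (by simpa using hx), smul_zero, add_zero]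
  have hcompl : (fun x => x + t • g x) '' (ball 0 L)ᶜ = (ball 0 L)ᶜ :=
    (EqOn.image_eq (f₂ := id) hfix).trans (image_id _)
  rw [← compl_inj_iff, ← image_compl_eq ⟨hinj, hsurj⟩, hcompl]

variable [MeasurableSpace E] [BorelSpace E]

/-- The change of variables formula for the Lipschitz bijection `x ↦ x + t g(x)` of the ball, which is
differentiable almost everywhere by Rademacher's theorem. The Hausdorff measure of full dimension
serves as Haar measure because Lipschitz images of its null sets are visibly null. -/
theorem integral_det_one_add_smul_fderiv {g : E → E} {K : ℝ≥0} {L t : ℝ} (hg : LipschitzWith K g)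
    (hsupp : ∀ x, L ≤ ‖x‖ → g x = 0) (ht : |t| * K < 1)
    (hdet : ∀ A : E →L[ℝ] E, ‖A‖ ≤ K → 0 < (1 + t • A).det) :
    IntegrableOn (fun x => (1 + t • fderiv ℝ g x).det) (ball 0 L) μH[Module.finrank ℝ E] ∧
    ∫ x in ball 0 L, (1 + t • fderiv ℝ g x).det ∂μH[Module.finrank ℝ E] =
      (μH[Module.finrank ℝ E] : Measure E).real (ball 0 L) := by
  set μ : Measure E := μH[Module.finrank ℝ E] with hμ
  set f : E → E := fun x => x + t • g x with hf
  obtain ⟨hinj, himg⟩ := image_ball_id_add_smul hg hsupp ht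
  set S : Set E := {x | DifferentiableAt ℝ g x} with hS
  set D : Set E := ball 0 L ∩ S with hD
  have hDmeas : MeasurableSet D := measurableSet_ball.inter (measurableSet_of_differentiableAt ℝ g)
  have hnull : μ Sᶜ = 0 := hg.ae_differentiableAt (μ := μ)
  have hae : D =ᵐ[μ] ball 0 L := inter_ae_eq_left_of_ae_eq_univ (ae_eq_univ.2 hnull)
  have hder : ∀ x ∈ D, HasFDerivWithinAt f (1 + t • fderiv ℝ g x) D x := by
    intro x hx
    exact ((hasFDerivAt_id x).add (hx.2.hasFDerivAt.const_smul t)).hasFDerivWithinAt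
  have hinjD : InjOn f D := hinj.mono (subset_univ _)
  have hflip : LipschitzWith (1 + ‖t‖₊ * K) f := LipschitzWith.id.add ((lipschitzWith_smul t).comp hg)
  have hfnull : μ (f '' Sᶜ) = 0 := by
    have h := hflip.hausdorffMeasure_image_le (d := Module.finrank ℝ E) (Nat.cast_nonneg _) Sᶜ
    rw [← hμ, hnull, mul_zero] at h
    exact le_antisymm h zero_le
  -- The image of the differentiability points of the ball fills the ball up to a null set.
  have hfae : f '' D =ᵐ[μ] ball 0 L := by
    have hsub : f '' D ⊆ ball 0 L := himg ▸ image_mono inter_subset_left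
    refine Filter.EventuallyLE.antisymm hsub.eventuallyLE ?_
    rw [ae_le_set]
    refine measure_mono_null ?_ hfnull
    rintro y ⟨hy, hy'⟩
    obtain ⟨x, hx, rfl⟩ := himg.ge hy
    exact ⟨x, fun hxS => hy' ⟨x, ⟨hx, hxS⟩, rfl⟩, rfl⟩
  have habs : ∀ x, |(1 + t • fderiv ℝ g x).det| = (1 + t • fderiv ℝ g x).det := fun x =>
    abs_of_pos (hdet _ (norm_fderiv_le_of_lipschitz ℝ hg))
  have hint := (integrableOn_image_iff_integrableOn_abs_det_fderiv_smul μ hDmeas hder hinjD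
    (fun _ => (1 : ℝ))).1 (by
      rw [integrableOn_congr_set_ae hfae]
      exact integrableOn_const measure_ball_lt_top.ne)
  have hval := integral_image_eq_integral_abs_det_fderiv_smul μ hDmeas hder hinjD
    (fun _ => (1 : ℝ))
  simp only [habs, smul_eq_mul, mul_one] at hint hval
  refine ⟨(integrableOn_congr_set_ae hae).1 hint, ?_⟩
  rw [← setIntegral_congr_set hae, ← hval, setIntegral_congr_set hfae]
  simp

/-- The integral of the Jacobian determinant of `id + g` over the ball is the volume of the ball,
although `id + g` need not be injective: this is `integral_det_one_add_smul_fderiv` for small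
multiples of `g`, extrapolated to `g` itself. -/
theorem integral_det_one_add_fderiv {g : E → E} {K : ℝ≥0} {L : ℝ} (hg : LipschitzWith K g)
    (hsupp : ∀ x, L ≤ ‖x‖ → g x = 0) :
    ∫ x in ball 0 L, (1 + fderiv ℝ g x).det ∂μH[Module.finrank ℝ E] =
      (μH[Module.finrank ℝ E] : Measure E).real (ball 0 L) := by
  have hcont : ContinuousAt (fun A : E →L[ℝ] E => A.det) 1 :=
    ContinuousLinearMap.continuous_det.continuousAt
  -- `ε` is a radius around the identity in which determinants stay positive; the nodes `t i` are
  -- chosen so small that `|t i| * K < min 1 ε`.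
  have hpos : ∀ᶠ A : E →L[ℝ] E in nhds 1, 0 < A.det :=
    hcont.eventually_const_lt (by simp [ContinuousLinearMap.det])
  obtain ⟨ε, hε, hball⟩ := Metric.eventually_nhds_iff.1 hpos
  set N : ℝ := Module.finrank ℝ E + 1 with hN
  have hNpos : 0 < N := by positivity
  set δ : ℝ := min 1 ε / (N * (K + 1)) with hδ
  have hδpos : 0 < δ := by positivity
  set t : Fin (Module.finrank ℝ E + 1) → ℝ := fun i => i * δ with ht
  have htinj : Function.Injective t := by
    intro i j hij
    have := mul_right_cancel₀ hδpos.ne' hij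
    exact Fin.ext (by exact_mod_cast this)
  have htK : ∀ i, |t i| * K < min 1 ε := by
    intro i
    have hi : (i : ℝ) ≤ N := by
      rw [hN]; exact_mod_cast i.2.le
    rw [ht, abs_of_nonneg (by positivity)]
    calc (i : ℝ) * δ * K ≤ N * δ * K := by gcongr
      _ < N * δ * (K + 1) := by gcongr; linarith
      _ = min 1 ε := by rw [hδ]; field_simp
  obtain ⟨w, hw⟩ := exists_weights_continuousLinearMap_det_one_add (E := E) t htinj
  have hstep := fun i => integral_det_one_add_smul_fderiv hg hsupp
    ((htK i).trans_le (min_le_left _ _)) (fun A hA => hball (by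
      rw [dist_eq_norm, add_sub_cancel_left, norm_smul, Real.norm_eq_abs]
      exact (mul_le_mul_of_nonneg_left hA (abs_nonneg _)).trans_lt
        ((htK i).trans_le (min_le_right _ _))))
  have hw1 : ∑ i, w i = 1 := by
    have := hw 0
    simpa [ContinuousLinearMap.det] using this.symm
  rw [show (fun x => (1 + fderiv ℝ g x).det) =
    fun x => ∑ i, w i * (1 + t i • fderiv ℝ g x).det from funext fun x => hw _]
  rw [integral_finsetSum _ fun i _ => ((hstep i).1.const_mul (w i))]
  simp_rw [integral_const_mul, (hstep _).2]
  rw [← Finset.sum_mul, hw1, one_mul]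

end Jacobian

/-! ### Brouwer's fixed point theorem for Lipschitz maps -/

variable {E : Type*} [NormedAddCommGroup E] [NormedSpace ℝ E]

/-- The product of a bounded Lipschitz function `a` and a Lipschitz map `b` is Lipschitz as soon as `b`
is bounded where `a` does not vanish. -/
theorem LipschitzWith.smul_of_bounded {X : Type*} [PseudoMetricSpace X] {a : X → ℝ} {b : X → E}
    {Ka Kb C B : ℝ≥0} (ha : LipschitzWith Ka a) (hb : LipschitzWith Kb b)
    (haC : ∀ x, |a x| ≤ C) (hbB : ∀ x, a x ≠ 0 → ‖b x‖ ≤ B) :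
    LipschitzWith (Ka * B + C * Kb) fun x => a x • b x := by
  have key : ∀ x y, a x ≠ 0 → ‖a x • b x - a y • b y‖ ≤ (Ka * B + C * Kb) * dist x y := by
    intro x y hx
    have h1 : a x • b x - a y • b y = (a x - a y) • b x + a y • (b x - b y) := by
      rw [sub_smul, smul_sub]; abel
    have h2 := ha.dist_le_mul x y
    have h3 := hb.dist_le_mul x y
    rw [Real.dist_eq] at h2
    rw [dist_eq_norm] at h3
    calc ‖a x • b x - a y • b y‖ ≤ |a x - a y| * ‖b x‖ + |a y| * ‖b x - b y‖ := by
          rw [h1]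
          refine (norm_add_le _ _).trans_eq ?_
          rw [norm_smul, norm_smul, Real.norm_eq_abs, Real.norm_eq_abs]
      _ ≤ (Ka * dist x y) * B + C * (Kb * dist x y) := by
          gcongr
          · exact hbB x hx
          · exact haC y
      _ = _ := by ring
  refine LipschitzWith.of_dist_le_mul fun x y => ?_
  rw [dist_eq_norm]
  push_cast
  by_cases hx : a x = 0
  · by_cases hy : a y = 0
    · simp only [hx, hy, zero_smul, sub_self, norm_zero]; positivity
    · rw [norm_sub_rev, dist_comm]; exact key y x hy
  · exact key x y hx

theorem lipschitzWith_div_max {ρ δ : ℝ} (hρ : 0 ≤ ρ) (hδ : 0 < δ) :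
    LipschitzWith (Real.toNNReal (ρ / δ ^ 2)) fun s : ℝ => ρ / max s δ := by
  refine LipschitzWith.of_dist_le_mul fun s s' => ?_
  have h1 : δ ≤ max s δ := le_max_right _ _
  have h2 : δ ≤ max s' δ := le_max_right _ _
  have h3 : |max s' δ - max s δ| ≤ |s - s'| := by
    rw [abs_sub_comm s]; exact abs_max_sub_max_le_abs _ _ _
  have h1' := hδ.trans_le h1
  have h2' := hδ.trans_le h2
  rw [Real.coe_toNNReal _ (by positivity), Real.dist_eq, Real.dist_eq,
    div_sub_div _ _ h1'.ne' h2'.ne', ← mul_comm ρ, ← mul_sub, abs_div, abs_mul, abs_of_nonneg hρ,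
    abs_of_pos (mul_pos h1' h2'), div_mul_eq_mul_div]
  have : δ ^ 2 ≤ max s δ * max s' δ := by rw [sq]; gcongr
  gcongr

/-- A map with values in a sphere has singular derivative. If the derivative were onto, some direction
`v` would be mapped to the radial vector `f x`, and the norm of `f` would grow along `v`; this works
for an arbitrary norm. -/
theorem HasFDerivAt.det_eq_zero_of_norm_eventually_eq {f : E → E} {f' : E →L[ℝ] E}
    {x : E} {ρ : ℝ} [FiniteDimensional ℝ E] (hρ : 0 < ρ) (hf : HasFDerivAt f f' x)
    (hnorm : ∀ᶠ y in nhds x, ‖f y‖ = ρ) : f'.det = 0 := by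
  by_contra hdet
  obtain ⟨v, hv⟩ : ∃ v, f' v = f x := by
    have hs := (LinearMap.equivOfDetNeZero (f' : E →ₗ[ℝ] E) hdet).surjective (f x)
    exact hs
  have hline : HasDerivAt (fun t : ℝ => f (x + t • v)) (f x) 0 := by
    have h0 : HasDerivAt (fun t : ℝ => x + t • v) v 0 := by
      simpa using ((hasDerivAt_id (0 : ℝ)).smul_const v).const_add x
    have h1 : HasFDerivAt f f' (x + (0 : ℝ) • v) := by simpa using hf
    simpa [hv, Function.comp_def] using h1.comp_hasDerivAt (0 : ℝ) h0
  have ho := (hasDerivAt_iff_isLittleO.1 hline).def (c := ρ / 2) (by positivity)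
  have htend : Filter.Tendsto (fun t : ℝ => x + t • v) (nhds 0) (nhds x) := by
    have : Continuous fun t : ℝ => x + t • v := by fun_prop
    simpa using this.tendsto 0
  have hn := htend.eventually hnorm
  obtain ⟨ε, hε, hball⟩ := Metric.eventually_nhds_iff.1 (ho.and hn)
  obtain ⟨h1, h2⟩ := @hball (ε / 2) (by
    rw [dist_zero_right, Real.norm_of_nonneg (by positivity)]; linarith)
  have h3 : ‖f x‖ = ρ := hnorm.self_of_nhds
  simp only [zero_smul, add_zero, sub_zero] at h1
  have h4 : (1 + ε / 2) • f x = f (x + (ε / 2) • v) - (f (x + (ε / 2) • v) - f x - (ε / 2) • f x) := by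
    rw [add_smul, one_smul]; abel
  have h5 := norm_sub_le (f (x + (ε / 2) • v)) (f (x + (ε / 2) • v) - f x - (ε / 2) • f x)
  rw [← h4, norm_smul, h2, h3, Real.norm_of_nonneg (by positivity)] at h5
  rw [Real.norm_of_nonneg (by positivity : (0 : ℝ) ≤ ε / 2)] at h1
  nlinarith [mul_pos hρ hε]

/-- No Lipschitz retraction of the space onto the complement of a ball: its Jacobian determinant would
vanish almost everywhere in the ball, yet integrate to the volume of the ball. -/
theorem not_exists_lipschitz_retraction [FiniteDimensional ℝ E] {r : E → E} {K : ℝ≥0} {ρ : ℝ}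
    (hρ : 0 < ρ) (hr : LipschitzWith K r) (hout : ∀ x, ρ ≤ ‖x‖ → r x = x)
    (hin : ∀ x, ‖x‖ < ρ → ‖r x‖ = ρ) : False := by
  borelize E
  have hg : LipschitzWith (K + 1) fun x => r x - x := hr.sub LipschitzWith.id
  have h := integral_det_one_add_fderiv hg (L := ρ) fun x hx => by rw [hout x hx, sub_self]
  have hzero : ∫ x in ball (0 : E) ρ, (1 + fderiv ℝ (fun x => r x - x) x).det
      ∂μH[Module.finrank ℝ E] = 0 := by
    refine integral_eq_zero_of_ae ?_
    filter_upwards [ae_restrict_mem measurableSet_ball, ae_restrict_of_ae (hg.ae_differentiableAt)]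
      with x hx hd
    refine HasFDerivAt.det_eq_zero_of_norm_eventually_eq (f := r) (x := x) hρ ?_ ?_
    · have hsum : id + (fun x => r x - x) = r := funext fun y => add_sub_cancel _ _
      have hadd := (hasFDerivAt_id x).add hd.hasFDerivAt
      rwa [hsum] at hadd
    · filter_upwards [isOpen_ball.mem_nhds hx] with y hy
      exact hin y (by simpa using hy)
  rw [hzero] at h
  have hpos : 0 < (μH[Module.finrank ℝ E] : Measure E).real (ball 0 ρ) :=
    ENNReal.toReal_pos (measure_ball_pos _ _ hρ).ne' measure_ball_lt_top.ne
  exact hpos.ne h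

/-- Brouwer's fixed point theorem for bounded Lipschitz self-maps of a finite-dimensional normed space.
Without a fixed point, cutting `h` off far away and rescaling `id - h` inside a large ball
to the sphere would give a Lipschitz retraction. -/
theorem LipschitzWith.exists_eq_of_bounded [FiniteDimensional ℝ E] {h : E → E} {K L : ℝ≥0}
    (hh : LipschitzWith K h) (hL : ∀ x, ‖h x‖ ≤ L) : ∃ x, h x = x := by
  by_contra! hne
  have hL0 : 0 < L := by
    rcases eq_or_lt_of_le (zero_le : 0 ≤ L) with h0 | h0
    · have h1 : ∀ x, h x = 0 := fun x => norm_le_zero_iff.1 (by simpa [← h0] using hL x)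
      exact absurd (h1 0) (hne 0)
    · exact h0
  have hL0' : (0 : ℝ) < L := hL0
  -- Cut-off function: `1` on the ball of radius `L`, `0` outside the ball of radius `2 * L`.
  set χ : E → ℝ := fun x => max 0 (min 1 (2 - ‖x‖ / L)) with hχ
  have hχ0 : ∀ x, 0 ≤ χ x := fun x => le_max_left _ _
  have hχ1 : ∀ x, χ x ≤ 1 := fun x => max_le zero_le_one (min_le_left _ _)
  have hχin : ∀ x, ‖x‖ ≤ L → χ x = 1 := by
    intro x hx
    have : ‖x‖ / L ≤ 1 := (div_le_one hL0').2 hx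
    rw [hχ]
    simp only
    rw [min_eq_left (by linarith), max_eq_right zero_le_one]
  have hχout : ∀ x, 2 * L ≤ ‖x‖ → χ x = 0 := by
    intro x hx
    have : 2 ≤ ‖x‖ / L := (le_div_iff₀ hL0').2 hx
    exact max_eq_left ((min_le_right _ _).trans (by linarith))
  have hχlip : ∃ C, LipschitzWith C χ := by
    have h1 : LipschitzWith (‖(L : ℝ)⁻¹‖₊ * 1) fun x : E => (L : ℝ)⁻¹ • ‖x‖ :=
      (lipschitzWith_smul _).comp lipschitzWith_one_norm
    have h2 := (((LipschitzWith.const (2 : ℝ)).sub h1).const_min 1).const_max 0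
    simp only [smul_eq_mul, ← div_eq_inv_mul] at h2
    exact ⟨_, h2⟩
  obtain ⟨Cχ, hχlip⟩ := hχlip
  have hmul := hχlip.smul_of_bounded hh (C := 1) (fun x => by
    rw [abs_of_nonneg (hχ0 x)]; exact hχ1 x) fun x _ => hL x
  -- A zero of `H` has norm at most `L`, where `χ = 1`, so it is a fixed point of `h`.
  set H : E → E := fun x => x - χ x • h x with hH
  have hHlip := LipschitzWith.id.sub hmul
  have hHne : ∀ x, H x ≠ 0 := by
    intro x hx
    have hx' : x = χ x • h x := sub_eq_zero.1 hx
    have hn : ‖x‖ ≤ L := by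
      rw [hx', norm_smul, Real.norm_of_nonneg (hχ0 _)]
      exact (mul_le_of_le_one_left (norm_nonneg _) (hχ1 _)).trans (hL _)
    rw [hχin x hn, one_smul] at hx'
    exact hne x hx'.symm
  have hHout : ∀ x, 2 * L ≤ ‖x‖ → H x = x := by
    intro x hx
    rw [hH]; simp only; rw [hχout x hx, zero_smul, sub_zero]
  obtain ⟨δ, hδ, hHδ⟩ : ∃ δ > 0, ∀ x, δ ≤ ‖H x‖ := by
    obtain ⟨x₀, -, hx₀⟩ := (isCompact_closedBall (0 : E) (2 * L)).exists_isMinOn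
      ⟨0, by simp⟩ (hHlip.continuous.norm.continuousOn)
    refine ⟨min ‖H x₀‖ (2 * L), lt_min (norm_pos_iff.2 (hHne x₀)) (by positivity), fun x => ?_⟩
    rcases le_total ‖x‖ (2 * L) with hx | hx
    · exact (min_le_left _ _).trans (hx₀ (by simpa using hx))
    · rw [hHout x hx]; exact (min_le_right _ _).trans hx
  -- `‖H x‖ ≤ 2 * L + L` where `H` differs from the identity, whence the radius `3 * L`.
  set ρ : ℝ := 3 * L with hρ
  have hρ0 : 0 < ρ := by positivity
  -- For `δ ≤ ‖y‖ ≤ ρ` the vector `y + a y • y` is the radial projection of `y` to the sphere of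
  -- radius `ρ`; for `‖y‖ ≥ ρ` it is `y`.
  set a : E → ℝ := fun y => max 0 (ρ / max ‖y‖ δ - 1) with ha
  have halip : LipschitzWith _ a := ((((lipschitzWith_div_max hρ0.le hδ).comp
    lipschitzWith_one_norm).sub (LipschitzWith.const (1 : ℝ))).const_max 0)
  have haout : ∀ y, ρ ≤ ‖y‖ → a y = 0 := by
    intro y hy
    refine max_eq_left (sub_nonpos.2 ((div_le_one (lt_max_of_lt_right hδ)).2 ?_))
    exact hy.trans (le_max_left _ _)
  have habd : ∀ y, |a y| ≤ (ρ / δ).toNNReal := by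
    intro y
    rw [abs_of_nonneg (le_max_left _ _), Real.coe_toNNReal _ (by positivity)]
    refine max_le (by positivity) ?_
    have : ρ / max ‖y‖ δ ≤ ρ / δ := by gcongr; exact le_max_right _ _
    linarith
  have hNlip := halip.smul_of_bounded LipschitzWith.id (B := ρ.toNNReal) habd (fun y hy => by
    rw [Real.coe_toNNReal _ hρ0.le]
    by_contra! hlt
    exact hy (haout y hlt.le))
  have hrlip := (LipschitzWith.id.add hNlip).comp hHlip
  refine not_exists_lipschitz_retraction hρ0 hrlip ?_ ?_
  · intro x hx
    show H x + a (H x) • H x = x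
    rw [hHout x (by linarith), haout x hx, zero_smul, add_zero]
  · intro x hx
    show ‖H x + a (H x) • H x‖ = ρ
    have hle : ‖H x‖ ≤ ρ := by
      rcases le_total ‖x‖ (2 * L) with hx2 | hx2
      · calc ‖H x‖ ≤ ‖x‖ + ‖χ x • h x‖ := _root_.norm_sub_le _ _
          _ ≤ 2 * L + L := by
            gcongr
            rw [norm_smul, Real.norm_of_nonneg (hχ0 _)]
            exact (mul_le_of_le_one_left (norm_nonneg _) (hχ1 _)).trans (hL _)
          _ = ρ := by rw [hρ]; ring
      · rw [hHout x hx2]; exact hx.le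
    have hpos : 0 < ‖H x‖ := hδ.trans_le (hHδ x)
    have hax : a (H x) = ρ / ‖H x‖ - 1 := by
      rw [ha]; simp only
      rw [max_eq_left (hHδ x), max_eq_right]
      rw [sub_nonneg, one_le_div hpos]; exact hle
    have : H x + a (H x) • H x = (ρ / ‖H x‖) • H x := by
      rw [hax, sub_smul, one_smul]; abel
    rw [this, norm_smul, Real.norm_of_nonneg (by positivity), div_mul_cancel₀ _ hpos.ne']

end Brouwer

/-! ### Complementarity problems and nonnegative tensors -/

section Complementarity

open Set

theorem RealTensor.contDiff_apply {m n : ℕ} (A : RealTensor m n) : ContDiff ℝ 1 A.apply := by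
  unfold RealTensor.apply
  fun_prop

theorem RealTensor.consIndex_const {m n : ℕ} (i : Fin n) :
    consIndex (m := m) i (fun _ => i) = fun _ => i := by
  funext k
  simp [consIndex]

theorem RealTensor.apply_nonneg {m n : ℕ} {A : RealTensor m n} (hA : ∀ I, 0 ≤ A I)
    {x : Fin n → ℝ} (hx : 0 ≤ x) : 0 ≤ A.apply x := fun _ =>
  Finset.sum_nonneg fun _ _ => mul_nonneg (hA _) (Finset.prod_nonneg fun _ _ => hx _)

theorem RealTensor.diag_mul_pow_le_apply {m n : ℕ} {A : RealTensor m n} (hA : ∀ I, 0 ≤ A I)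
    {x : Fin n → ℝ} (hx : 0 ≤ x) (i : Fin n) :
    A (fun _ => i) * x i ^ (m - 1) ≤ A.apply x i := by
  have h := Finset.single_le_sum
    (f := fun J : Fin (m - 1) → Fin n => A (consIndex i J) * ∏ k, x (J k))
    (fun J _ => mul_nonneg (hA _) (Finset.prod_nonneg fun _ _ => hx _))
    (Finset.mem_univ fun _ => i)
  simpa [consIndex_const, RealTensor.apply] using h

/-- On vectors supported at `i`, only the diagonal entry contributes to the `i`-th component. -/
theorem RealTensor.apply_single {m n : ℕ} (A : RealTensor m n) {x : Fin n → ℝ} {i : Fin n}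
    (hx : ∀ j ≠ i, x j = 0) : A.apply x i = A (fun _ => i) * x i ^ (m - 1) := by
  unfold RealTensor.apply
  rw [Finset.sum_eq_single fun _ => i]
  · simp [consIndex_const]
  · intro J _ hJ
    obtain ⟨k, hk⟩ := Function.ne_iff.1 hJ
    rw [Finset.prod_eq_zero (Finset.mem_univ k) (hx _ hk), mul_zero]
  · simp

/-- The complementarity problem for `q = -eᵢ + ∑ j ≠ i, eⱼ` forces a solution to be supported at `i`,
and then the `i`-th inequality forces the diagonal entry to be positive. -/
theorem RealTensor.IsQTensor.diag_pos {m n : ℕ} {A : RealTensor m n} (hA : ∀ I, 0 ≤ A I)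
    (hQ : A.IsQTensor) (i : Fin n) : 0 < A fun _ => i := by
  obtain ⟨x, hx, hF, hcomp⟩ := hQ fun j => if j = i then -1 else 1
  have hAx := apply_nonneg hA hx
  have hx0 : ∀ j ≠ i, x j = 0 := by
    intro j hj
    have h := (Finset.sum_eq_zero_iff_of_nonneg fun k _ => mul_nonneg (hx k) (hF k)).1 hcomp j
      (Finset.mem_univ j)
    have h1 : 0 ≤ A.apply x j := hAx j
    rcases mul_eq_zero.1 h with h | h
    · exact h
    · simp only [Pi.add_apply, if_neg hj] at h
      linarith
  have hi := hF i
  simp only [Pi.add_apply, Pi.zero_apply, if_true, apply_single A hx0] at hi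
  by_contra hle
  have h0 : (A fun _ => i) = 0 := le_antisymm (not_lt.1 hle) (hA _)
  rw [h0] at hi
  linarith

/-- A nonlinear complementarity problem has a solution if each component of the map is positive on the
corresponding upper face of a box `[0, K]ⁿ`.
With `c` the projection to the box, a fixed point `x` of `x ↦ c x - F (c x)` lies below the upper
faces, so `c x = x⁺` and `F (c x) = x⁺ - x = x⁻`. -/
theorem exists_nonlinear_complementarity_solution {ι : Type*} [Fintype ι]
    {F : (ι → ℝ) → ι → ℝ} {K : ℝ} (hK : 0 ≤ K) (hF : ContDiff ℝ 1 F)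
    (hpos : ∀ x ∈ Icc (0 : ι → ℝ) (fun _ => K), ∀ i, x i = K → 0 < F x i) :
    ∃ x, 0 ≤ x ∧ 0 ≤ F x ∧ x ⬝ᵥ F x = 0 := by
  set c : (ι → ℝ) → ι → ℝ := fun x i => max 0 (min (x i) K) with hc
  have hcmem : ∀ x, c x ∈ Icc (0 : ι → ℝ) (fun _ => K) := fun x =>
    ⟨fun i => le_max_left _ _, fun i => max_le hK (min_le_right _ _)⟩
  have hclip : LipschitzWith 1 c := by
    refine LipschitzWith.of_dist_le_mul fun x y => ?_
    refine (dist_pi_le_iff (by positivity)).2 fun i => ?_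
    exact ((((LipschitzWith.eval i).min_const K).const_max 0).dist_le_mul x y)
  have hcompact : IsCompact (Icc (0 : ι → ℝ) (fun _ => K)) := isCompact_Icc
  have hG : ContDiff ℝ 1 fun x => x - F x := contDiff_id.sub hF
  obtain ⟨C, hC⟩ := hG.contDiffOn.exists_lipschitzOnWith one_ne_zero (convex_Icc _ _) hcompact
  have hlip : LipschitzWith (C * 1) fun x => c x - F (c x) :=
    lipschitzOnWith_univ.1 (hC.comp hclip.lipschitzOnWith fun x _ => hcmem x)
  obtain ⟨L, hL⟩ := hcompact.exists_bound_of_continuousOn hG.continuous.continuousOn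
  obtain ⟨x, hx⟩ := hlip.exists_eq_of_bounded (L := L.toNNReal) fun x =>
    (hL _ (hcmem x)).trans (Real.le_coe_toNNReal _)
  have hxi : ∀ i, c x i - F (c x) i = x i := fun i => congrFun hx i
  have hlt : ∀ i, x i < K := by
    intro i
    by_contra! hle
    have h1 : c x i = K := by
      simp only [hc]
      rw [min_eq_right hle, max_eq_right hK]
    have h2 := hpos _ (hcmem x) i h1
    have h3 := hxi i
    linarith
  have hci : ∀ i, c x i = max 0 (x i) := fun i => by
    simp only [hc]; rw [min_eq_left (hlt i).le]
  have hFi : ∀ i, F (c x) i = max 0 (x i) - x i := fun i => by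
    rw [← hci, ← hxi i]; ring
  refine ⟨c x, (hcmem x).1, fun i => ?_, Finset.sum_eq_zero fun i _ => ?_⟩
  · rw [hFi]; exact sub_nonneg.2 (le_max_right _ _)
  · rw [hFi, hci]
    rcases le_total 0 (x i) with h | h
    · rw [max_eq_right h, sub_self, mul_zero]
    · rw [max_eq_left h, zero_mul]

theorem RealTensor.isQTensor_of_diag_pos {m n : ℕ} (hm : 2 ≤ m) {A : RealTensor m n}
    (hA : ∀ I, 0 ≤ A I) (hdiag : ∀ i : Fin n, 0 < A fun _ => i) : A.IsQTensor := by
  intro q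
  -- `K` is at least `1` and exceeds every `|q i| / a i⋯i`, so `a i⋯i * K ^ (m - 1) > |q i|`.
  set K : ℝ := 1 + ∑ j, |q j| / A fun _ => j with hK
  have hterm : ∀ j, 0 ≤ |q j| / A fun _ => j := fun j => div_nonneg (abs_nonneg _) (hA _)
  have hK1 : 1 ≤ K := le_add_of_nonneg_right (Finset.sum_nonneg fun j _ => hterm j)
  refine exists_nonlinear_complementarity_solution (F := fun x => q + A.apply x) (K := K)
    (by linarith) (contDiff_const.add A.contDiff_apply) fun x hx i hxi => ?_
  have h1 := diag_mul_pow_le_apply hA hx.1 i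
  have h2 : K ≤ K ^ (m - 1) := le_self_pow₀ hK1 (by omega)
  have h3 : |q i| / (A fun _ => i) < K := by
    have := Finset.single_le_sum (fun j _ => hterm j) (Finset.mem_univ i)
    linarith
  rw [div_lt_iff₀ (hdiag i)] at h3
  rw [hxi] at h1
  have h4 := mul_le_mul_of_nonneg_left h2 (hdiag i).le
  have h5 := neg_abs_le (q i)
  simp only [Pi.add_apply]
  linarith

end Complementarity

theorem mainTheorem2 (m n : ℕ) (hm : 2 ≤ m) (A : RealTensor m n)
    (hA : ∀ I : Fin m → Fin n, 0 ≤ A I) :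
    A.IsQTensor ↔ ∀ i : Fin n, 0 < A (fun _ => i) :=
  ⟨fun hQ => hQ.diag_pos hA, RealTensor.isQTensor_of_diag_pos hm hA⟩
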